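/- Let $-\infty\le f_{\min}<0$ and let $f:\,]-1,+\infty[\,\to\,]f_{\min},+\infty[$ be a surjective function of class $C^2$ with $\lim_{y\to-1}f(y)=+\infty$, $f(0)=0$, $f'(0)=-1$ and $f'(y)<0<f''(y)$ for all $y>-1$. Let $\omega>0$, $T=2\pi/\omega$ and $\theta=\arctan\omega$. Then, for every $A>0$, the equation $y'(t)=f(y(t))+A\sin\omega t$ has a unique $T$-periodic solution $Y(\cdot,A):\mathbb{R}\to\,]-1,+\infty[$; the derivative $Z(t,A)=\frac{\partial Y}{\partial A}(t,A)$ exists for every $t$; each of the functions $Y(\cdot,A)$ and $Z(\cdot,A)$ has exactly two roots in $[0,T]$, denoted by $t_{Y_1}<t_{Y_2}$ and $t_{Z_1}<t_{Z_2}$ respectively; and $Y(\cdot,A)$ attains its maximum over $[0,T]$ at exactly one point $t_{Y_{\max}}\in[0,T]$. These times, which depend on $A$, have the following properties. For all $A>0$: (i) $[t_{Y_1},t_{Y_2}]\subset[t_{Z_1},t_{Z_2}]$, and $Z(t_{Y_1},A)\ge 0$, $Z(t_{Y_2},A)\ge 0$; (ii) $t_{Y_1}$ and $t_{Y_2}$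 are differentiable with respect to $A$, with $\frac{\partial t_{Y_1}}{\partial A}<0$ and $\frac{\partial t_{Y_2}}{\partial A}>0$; (iii) $t_{Y_1}<\frac{\theta}{\omega}<\frac{T}{4}$ and $t_{Y_2}>\frac{\theta}{\omega}+\frac{T}{2}$. Moreover: (iv) if $f_{\min}>-\infty$, then $\lim_{A\to+\infty}t_{Y_{\max}}=\frac{T}{2}$. -/

import Mathlib

open Set Filter Topology

/-- The nonlinearity of the model problem: a `C²` function on `]-1, +∞[` with range
`]fmin, +∞[`, where `-∞ ≤ fmin < 0`, which tends to `+∞` at `-1` and satisfies `f 0 = 0`,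
`f' 0 = -1` and `f' < 0 < f''`. The values of `f` outside `]-1, +∞[` are irrelevant. -/
structure IsCrackLaw (f : ℝ → ℝ) (fmin : EReal) : Prop where
  contDiffOn : ContDiffOn ℝ 2 f (Ioi (-1))
  fmin_neg : fmin < 0
  image_eq : f '' Ioi (-1) = {x : ℝ | fmin < (x : EReal)}
  tendsto_atTop : Tendsto f (𝓝[>] (-1)) atTop
  map_zero : f 0 = 0
  deriv_zero : deriv f 0 = -1
  deriv_neg : ∀ y, -1 < y → deriv f y < 0
  deriv_deriv_pos : ∀ y, -1 < y → 0 < deriv (deriv f) y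

/-- The period `T = 2π/ω` of the forcing. -/
noncomputable def forcingPeriod (ω : ℝ) : ℝ := 2 * Real.pi / ω

/-- `y` is a `T`-periodic solution, with values in `]-1, +∞[`, of `y' = f(y) + A sin(ωt)`. -/
structure IsPeriodicSolution (f : ℝ → ℝ) (ω A : ℝ) (y : ℝ → ℝ) : Prop where
  gt_neg_one : ∀ t, -1 < y t
  hasDerivAt : ∀ t, HasDerivAt y (f (y t) + A * Real.sin (ω * t)) t
  periodic : Function.Periodic y (forcingPeriod ω)

/-- `t₁ < t₂` are the roots of `u` in `[0, T]`: both are roots and there is no other one. -/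
def AreTheTwoRoots (u : ℝ → ℝ) (T t₁ t₂ : ℝ) : Prop :=
  t₁ < t₂ ∧ {t | t ∈ Icc 0 T ∧ u t = 0} = {t₁, t₂}

/-- `s` is the only point of `[0, T]` at which `u` is maximum over `[0, T]`. -/
def IsTheMaxTime (u : ℝ → ℝ) (T s : ℝ) : Prop :=
  s ∈ Icc 0 T ∧ ∀ t ∈ Icc 0 T, t ≠ s → u t < u s

/-! ### Periodic solutions of scalar linear equations -/

theorem exists_forall_le_of_periodic {u : ℝ → ℝ} {T : ℝ} (hT : 0 < T)
    (hu : Function.Periodic u T) (hc : Continuous u) : ∃ s, ∀ t, u t ≤ u s := by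
  obtain ⟨_, ⟨s, rfl⟩, hs⟩ :=
    (hu.compact_of_continuous hT.ne' hc).exists_isMaxOn (range_nonempty u) continuousOn_id
  exact ⟨s, fun t => hs (mem_range_self t)⟩

theorem exists_forall_ge_of_periodic {u : ℝ → ℝ} {T : ℝ} (hT : 0 < T)
    (hu : Function.Periodic u T) (hc : Continuous u) : ∃ s, ∀ t, u s ≤ u t := by
  obtain ⟨s, hs⟩ := exists_forall_le_of_periodic (u := fun t => -u t) hT
    (fun t => congrArg Neg.neg (hu t)) hc.neg
  exact ⟨s, fun t => neg_le_neg_iff.1 (hs t)⟩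

theorem HasDerivAt.eq_zero_of_forall_le {u : ℝ → ℝ} {d s : ℝ} (h : HasDerivAt u d s)
    (hs : ∀ t, u t ≤ u s) : d = 0 :=
  IsLocalMax.hasDerivAt_eq_zero (Eventually.of_forall hs) h

theorem HasDerivAt.eq_zero_of_forall_ge {u : ℝ → ℝ} {d s : ℝ} (h : HasDerivAt u d s)
    (hs : ∀ t, u s ≤ u t) : d = 0 :=
  IsLocalMin.hasDerivAt_eq_zero (Eventually.of_forall hs) h

theorem continuous_of_forall_hasDerivAt {u v : ℝ → ℝ} (h : ∀ t, HasDerivAt u (v t) t) :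
    Continuous u :=
  continuous_iff_continuousAt.2 fun t => (h t).continuousAt

/-- A periodic solution of `u' = q u + r` with `q < 0 ≤ r` is nonnegative. -/
theorem nonneg_of_periodic_of_hasDerivAt {u q r : ℝ → ℝ} {T : ℝ} (hT : 0 < T)
    (hu : Function.Periodic u T) (h : ∀ t, HasDerivAt u (q t * u t + r t) t)
    (hq : ∀ t, q t < 0) (hr : ∀ t, 0 ≤ r t) (t : ℝ) : 0 ≤ u t := by
  obtain ⟨s, hs⟩ := exists_forall_ge_of_periodic hT hu (continuous_of_forall_hasDerivAt h)
  have h0 := (h s).eq_zero_of_forall_ge hs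
  have : 0 ≤ u s := by
    by_contra! hneg
    have := mul_pos_of_neg_of_neg (hq s) hneg
    linarith [hr s]
  exact this.trans (hs t)

/-- A periodic solution of `u' = q u + r` with `q ≤ -δ` and `|r| ≤ ε` satisfies
`|u| ≤ ε / δ`. -/
theorem abs_le_of_periodic_of_hasDerivAt {u q r : ℝ → ℝ} {T δ ε : ℝ} (hT : 0 < T)
    (hu : Function.Periodic u T) (h : ∀ t, HasDerivAt u (q t * u t + r t) t) (hδ : 0 < δ)
    (hq : ∀ t, q t ≤ -δ) (hr : ∀ t, |r t| ≤ ε) (t : ℝ) : |u t| ≤ ε / δ := by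
  have hε : 0 ≤ ε := (abs_nonneg _).trans (hr t)
  have hp : 0 ≤ ε / δ := by positivity
  have hqε : ∀ t, q t * (ε / δ) + ε ≤ 0 := fun t => by
    have := mul_le_mul_of_nonneg_right (hq t) hp
    have h2 : -δ * (ε / δ) = -ε := by field_simp
    linarith
  have hq0 : ∀ t, q t < 0 := fun t => (hq t).trans_lt (neg_lt_zero.2 hδ)
  rw [abs_le]
  constructor
  · have := nonneg_of_periodic_of_hasDerivAt (u := fun t => u t + ε / δ) (q := q)
      (r := fun t => r t - q t * (ε / δ)) hT (fun t => congrArg (· + ε / δ) (hu t))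
      (fun t => ((h t).add_const (ε / δ)).congr_deriv (by ring)) hq0
      (fun t => by linarith [hqε t, (abs_le.1 (hr t)).1]) t
    linarith
  · have := nonneg_of_periodic_of_hasDerivAt (u := fun t => ε / δ - u t) (q := q)
      (r := fun t => - r t - q t * (ε / δ)) hT (fun t => congrArg (ε / δ - ·) (hu t))
      (fun t => ((h t).const_sub (ε / δ)).congr_deriv (by ring)) hq0
      (fun t => by linarith [hqε t, (abs_le.1 (hr t)).2]) t
    linarith

theorem exists_forall_hasDerivAt_of_continuous {q : ℝ → ℝ} (hq : Continuous q) :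
    ∃ Q : ℝ → ℝ, ∀ t, HasDerivAt Q (q t) t :=
  ⟨fun t => ∫ s in (0 : ℝ)..t, q s, fun t => (hq.integral_hasStrictDerivAt 0 t).hasDerivAt⟩

/-- The integrating factor of `u' = q u + r`. -/
theorem HasDerivAt.mul_exp_neg {u Q : ℝ → ℝ} {q r t : ℝ} (hu : HasDerivAt u (q * u t + r) t)
    (hQ : HasDerivAt Q q t) :
    HasDerivAt (fun t => u t * Real.exp (-Q t)) (r * Real.exp (-Q t)) t :=
  (hu.mul hQ.neg.exp).congr_deriv (by simp only [Pi.neg_apply]; ring)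

/-- A periodic solution of `u' = q u + r` with `q < 0 ≤ r` is positive unless `r = 0`. -/
theorem pos_of_periodic_of_hasDerivAt {u q r : ℝ → ℝ} {T : ℝ} (hT : 0 < T)
    (hu : Function.Periodic u T) (h : ∀ t, HasDerivAt u (q t * u t + r t) t)
    (hqc : Continuous q) (hq : ∀ t, q t < 0) (hr : ∀ t, 0 ≤ r t) (hr' : ∃ t, r t ≠ 0) (t : ℝ) :
    0 < u t := by
  have hnn := nonneg_of_periodic_of_hasDerivAt hT hu h hq hr
  refine (hnn t).lt_of_ne' fun ht => ?_
  obtain ⟨Q, hQ⟩ := exists_forall_hasDerivAt_of_continuous hqc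
  have hmono : Monotone fun t => u t * Real.exp (-Q t) :=
    monotone_of_hasDerivAt_nonneg (fun t => (h t).mul_exp_neg (hQ t))
      fun t => mul_nonneg (hr t) (Real.exp_pos _).le
  have hle : ∀ s ≤ t, u s = 0 := fun s hs => by
    have h1 : u s * Real.exp (-Q s) ≤ u t * Real.exp (-Q t) := hmono hs
    rw [ht, zero_mul] at h1
    exact le_antisymm (nonpos_of_mul_nonpos_left h1 (Real.exp_pos _)) (hnn s)
  have hzero : u = fun _ => 0 := by
    funext s
    obtain ⟨n, hn⟩ := exists_nat_ge ((s - t) / T)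
    rw [div_le_iff₀ hT] at hn
    rw [← hle (s - n * T) (by linarith), hu.sub_nat_mul_eq]
  obtain ⟨s, hs⟩ := hr'
  have h1 := h s
  rw [hzero] at h1
  exact hs (by simpa using h1.unique (hasDerivAt_const s (0 : ℝ)))

theorem forcingPeriod_pos {ω : ℝ} (hω : 0 < ω) : 0 < forcingPeriod ω := by
  unfold forcingPeriod; positivity

theorem mul_forcingPeriod {ω : ℝ} (hω : 0 < ω) : ω * forcingPeriod ω = 2 * Real.pi := by
  unfold forcingPeriod; field_simp

theorem periodic_sin_mul {ω : ℝ} (hω : 0 < ω) :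
    Function.Periodic (fun t => Real.sin (ω * t)) (forcingPeriod ω) := fun t => by
  simp only [mul_add, mul_forcingPeriod hω, Real.sin_add_two_pi]

theorem sin_mul_pos {ω t : ℝ} (hω : 0 < ω) (h0 : 0 < t) (h1 : t < forcingPeriod ω / 2) :
    0 < Real.sin (ω * t) := by
  have := mul_forcingPeriod hω
  exact Real.sin_pos_of_pos_of_lt_pi (by positivity) (by nlinarith)

theorem sin_mul_neg {ω t : ℝ} (hω : 0 < ω) (h0 : forcingPeriod ω / 2 < t)
    (h1 : t < forcingPeriod ω) : Real.sin (ω * t) < 0 := by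
  have := mul_forcingPeriod hω
  rw [← Real.sin_sub_two_pi]
  exact Real.sin_neg_of_neg_of_neg_pi_lt (by nlinarith) (by nlinarith)

theorem neg_of_hasDerivAt_sin {u q : ℝ → ℝ} {ω B : ℝ} (hω : 0 < ω) (hB : 0 < B)
    (hu : u (forcingPeriod ω) = u 0)
    (h : ∀ t, HasDerivAt u (q t * u t + B * Real.sin (ω * t)) t)
    (hqc : Continuous q) (hq : ∀ t, q t < 0) : u 0 < 0 := by
  set T := forcingPeriod ω with hTdef
  have hT : 0 < T := forcingPeriod_pos hω
  obtain ⟨Q, hQ⟩ := exists_forall_hasDerivAt_of_continuous hqc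
  have hQa : StrictAnti Q := strictAnti_of_hasDerivAt_neg hQ hq
  set E : ℝ → ℝ := fun t => Real.exp (-Q t) with hE
  have hEm : StrictMono E := fun a b hab => Real.exp_lt_exp.2 (neg_lt_neg (hQa hab))
  set G : ℝ → ℝ := fun t => u t * E t + B * E (T / 2) / ω * Real.cos (ω * t) with hG
  have hGd : ∀ t, HasDerivAt G (B * (E t - E (T / 2)) * Real.sin (ω * t)) t := fun t => by
    have h1 := ((hasDerivAt_id t).const_mul ω).cos.const_mul (B * E (T / 2) / ω)
    refine (((h t).mul_exp_neg (hQ t)).add h1).congr_deriv ?_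
    simp only [hE, id]
    field_simp
    ring
  have hGc : Continuous G := continuous_of_forall_hasDerivAt hGd
  have hG1 : G (T / 2) < G 0 := by
    refine strictAntiOn_of_deriv_neg (convex_Icc 0 (T / 2)) hGc.continuousOn (fun t ht => ?_)
      ⟨le_rfl, by positivity⟩ ⟨by positivity, le_rfl⟩ (by positivity)
    rw [interior_Icc] at ht
    rw [(hGd t).deriv]
    exact mul_neg_of_neg_of_pos (mul_neg_of_pos_of_neg hB (sub_neg.2 (hEm ht.2)))
      (sin_mul_pos hω ht.1 ht.2)
  have hG2 : G T < G (T / 2) := by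
    refine strictAntiOn_of_deriv_neg (convex_Icc (T / 2) T) hGc.continuousOn (fun t ht => ?_)
      ⟨le_rfl, by linarith⟩ ⟨by linarith, le_rfl⟩ (by linarith)
    rw [interior_Icc] at ht
    rw [(hGd t).deriv]
    exact mul_neg_of_pos_of_neg (mul_pos hB (sub_pos.2 (hEm ht.1))) (sin_mul_neg hω ht.1 ht.2)
  have h3 := hG2.trans hG1
  have hcos : Real.cos (ω * T) = 1 := by rw [hTdef, mul_forcingPeriod hω, Real.cos_two_pi]
  simp only [hG, hu, hcos, mul_zero, Real.cos_zero] at h3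
  have h4 : E 0 < E T := hEm hT
  by_contra! hneg
  have := mul_le_mul_of_nonneg_left h4.le hneg
  linarith

/-- `u` is negative on `[0, t₁)`, positive on `(t₁, t₂)` and negative on `(t₂, T]`, with
`0 < t₁ < T / 2 < t₂ < T`. -/
structure IsNegPosNeg (u : ℝ → ℝ) (T t₁ t₂ : ℝ) : Prop where
  pos_left : 0 < t₁
  left_lt : t₁ < T / 2
  lt_right : T / 2 < t₂
  right_lt : t₂ < T
  left_eq : u t₁ = 0
  right_eq : u t₂ = 0
  neg_of_lt : ∀ t, 0 ≤ t → t < t₁ → u t < 0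
  pos_of_mem : ∀ t, t₁ < t → t < t₂ → 0 < u t
  neg_of_gt : ∀ t, t₂ < t → t ≤ T → u t < 0

theorem IsNegPosNeg.areTheTwoRoots {u : ℝ → ℝ} {T t₁ t₂ : ℝ} (h : IsNegPosNeg u T t₁ t₂) :
    AreTheTwoRoots u T t₁ t₂ := by
  have h1 := h.pos_left
  have h2 := h.left_lt
  have h3 := h.lt_right
  have h4 := h.right_lt
  refine ⟨by linarith, ?_⟩
  ext t
  simp only [mem_ofPred_eq, mem_Icc, mem_insert_iff, mem_singleton_iff]
  constructor
  · rintro ⟨⟨h5, h6⟩, h7⟩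
    rcases lt_trichotomy t t₁ with h8 | h8 | h8
    · exact absurd h7 (h.neg_of_lt t h5 h8).ne
    · exact Or.inl h8
    · rcases lt_trichotomy t t₂ with h9 | h9 | h9
      · exact absurd h7 (h.pos_of_mem t h8 h9).ne'
      · exact Or.inr h9
      · exact absurd h7 (h.neg_of_gt t h9 h6).ne
  · rintro (rfl | rfl)
    · exact ⟨⟨by linarith, by linarith⟩, h.left_eq⟩
    · exact ⟨⟨by linarith, by linarith⟩, h.right_eq⟩

theorem IsNegPosNeg.mem_Icc_of_nonneg {u : ℝ → ℝ} {T t₁ t₂ t : ℝ} (h : IsNegPosNeg u T t₁ t₂)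
    (h0 : 0 ≤ t) (hT : t ≤ T) (ht : 0 ≤ u t) : t ∈ Icc t₁ t₂ :=
  ⟨not_lt.1 fun hlt => ht.not_gt (h.neg_of_lt t h0 hlt),
    not_lt.1 fun hlt => ht.not_gt (h.neg_of_gt t hlt hT)⟩

theorem IsNegPosNeg.mem_Ioo_of_pos {u : ℝ → ℝ} {T t₁ t₂ t : ℝ} (h : IsNegPosNeg u T t₁ t₂)
    (h0 : 0 ≤ t) (hT : t ≤ T) (ht : 0 < u t) : t ∈ Ioo t₁ t₂ := by
  obtain ⟨h1, h2⟩ := h.mem_Icc_of_nonneg h0 hT ht.le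
  refine ⟨h1.lt_of_ne ?_, h2.lt_of_ne ?_⟩
  · rintro rfl
    exact ht.ne' h.left_eq
  · rintro rfl
    exact ht.ne' h.right_eq

/-- The sign of a periodic solution of `u' = q u + B sin ωt` with `q < 0 < B`. -/
theorem exists_isNegPosNeg {u q : ℝ → ℝ} {ω B : ℝ} (hω : 0 < ω) (hB : 0 < B)
    (hu : Function.Periodic u (forcingPeriod ω))
    (h : ∀ t, HasDerivAt u (q t * u t + B * Real.sin (ω * t)) t)
    (hqc : Continuous q) (hq : ∀ t, q t < 0) :
    ∃ t₁ t₂, IsNegPosNeg u (forcingPeriod ω) t₁ t₂ := by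
  set T := forcingPeriod ω with hTdef
  have hT : 0 < T := forcingPeriod_pos hω
  have hu0 : u 0 < 0 := neg_of_hasDerivAt_sin hω hB (by simpa using hu 0) h hqc hq
  have huT : u T < 0 := by simpa using (hu 0).trans_lt hu0
  have hmid : 0 < u (T / 2) := by
    have hsin : ∀ t, Real.sin (ω * (t - T / 2)) = - Real.sin (ω * t) := fun t => by
      have : ω * (t - T / 2) = ω * t - Real.pi := by
        linear_combination (-1 / 2) * mul_forcingPeriod hω
      rw [this, Real.sin_sub_pi]
    have h1 := neg_of_hasDerivAt_sin (u := fun t => - u (t - T / 2))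
      (q := fun t => q (t - T / 2)) hω hB
      (by
        have := hu (0 - T / 2)
        rw [zero_sub, neg_add_eq_sub] at this
        simpa using this)
      (fun t => ((h (t - T / 2)).comp_sub_const t (T / 2)).neg.congr_deriv (by
        rw [hsin]; ring))
      (hqc.comp (continuous_id.sub continuous_const)) (fun t => hq _)
    have h2 := hu (0 - T / 2)
    have h3 : 0 - T / 2 + T = T / 2 := by ring
    rw [h3] at h2
    rw [h2]
    linarith
  obtain ⟨Q, hQ⟩ := exists_forall_hasDerivAt_of_continuous hqc
  set W : ℝ → ℝ := fun t => u t * Real.exp (-Q t) with hW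
  have hWd : ∀ t, HasDerivAt W (B * Real.sin (ω * t) * Real.exp (-Q t)) t := fun t =>
    (h t).mul_exp_neg (hQ t)
  have hWc : Continuous W := continuous_of_forall_hasDerivAt hWd
  have hWpos : ∀ t, 0 < W t ↔ 0 < u t := fun t => mul_pos_iff_of_pos_right (Real.exp_pos _)
  have hWneg : ∀ t, W t < 0 ↔ u t < 0 := fun t => by
    simp only [hW]
    constructor
    · intro h
      exact neg_of_mul_neg_left h (Real.exp_pos _).le
    · intro h
      exact mul_neg_of_neg_of_pos h (Real.exp_pos _)
  have hWzero : ∀ t, W t = 0 → u t = 0 := fun t h =>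
    (mul_eq_zero.1 h).resolve_right (Real.exp_pos _).ne'
  have hmono : StrictMonoOn W (Icc 0 (T / 2)) := by
    refine strictMonoOn_of_deriv_pos (convex_Icc _ _) hWc.continuousOn fun t ht => ?_
    rw [interior_Icc] at ht
    rw [(hWd t).deriv]
    exact mul_pos (mul_pos hB (sin_mul_pos hω ht.1 ht.2)) (Real.exp_pos _)
  have hanti : StrictAntiOn W (Icc (T / 2) T) := by
    refine strictAntiOn_of_deriv_neg (convex_Icc _ _) hWc.continuousOn fun t ht => ?_
    rw [interior_Icc] at ht
    rw [(hWd t).deriv]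
    exact mul_neg_of_neg_of_pos (mul_neg_of_pos_of_neg hB (sin_mul_neg hω ht.1 ht.2))
      (Real.exp_pos _)
  obtain ⟨t₁, ⟨h1, h2⟩, h3⟩ := intermediate_value_Ioo (by positivity : (0 : ℝ) ≤ T / 2)
    hWc.continuousOn (show (0 : ℝ) ∈ Ioo (W 0) (W (T / 2)) from ⟨(hWneg _).2 hu0, (hWpos _).2 hmid⟩)
  obtain ⟨t₂, ⟨h4, h5⟩, h6⟩ := intermediate_value_Ioo' (by linarith : T / 2 ≤ T)
    hWc.continuousOn (show (0 : ℝ) ∈ Ioo (W T) (W (T / 2)) from ⟨(hWneg _).2 huT, (hWpos _).2 hmid⟩)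
  refine ⟨t₁, t₂, h1, h2, h4, h5, hWzero _ h3, hWzero _ h6, fun t h7 h8 => ?_, fun t h7 h8 => ?_,
    fun t h7 h8 => ?_⟩
  · rw [← hWneg, ← h3]
    exact hmono ⟨h7, by linarith⟩ ⟨h1.le, h2.le⟩ h8
  · rw [← hWpos]
    rcases le_total t (T / 2) with h9 | h9
    · rw [← h3]
      exact hmono ⟨h1.le, h2.le⟩ ⟨by linarith, h9⟩ h7
    · rw [← h6]
      exact hanti ⟨h9, by linarith⟩ ⟨h4.le, h5.le⟩ h8
  · rw [← hWneg, ← h6]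
    exact hanti ⟨h4.le, h5.le⟩ ⟨by linarith, h8⟩ h7

/-! ### Existence of periodic solutions of dissipative scalar equations -/

open MeasureTheory in
/-- The bounded solution of `u' = -L u + h`, for `h` bounded. -/
noncomputable def relaxation (L : ℝ) (h : ℝ → ℝ) (t : ℝ) : ℝ :=
  Real.exp (-(L * t)) * ∫ s in Iic t, Real.exp (L * s) * h s

section relaxation

open MeasureTheory

variable {L C : ℝ} {h k : ℝ → ℝ}

theorem integrableOn_exp_mul_of_bounded (hL : 0 < L) (hc : Continuous h) (hb : ∀ t, |h t| ≤ C)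
    (t : ℝ) : IntegrableOn (fun s => Real.exp (L * s) * h s) (Iic t) := by
  refine (integrableOn_exp_mul_Iic hL t).mul_bdd (c := C) hc.aestronglyMeasurable ?_
  exact Eventually.of_forall hb

theorem hasDerivAt_relaxation (hL : 0 < L) (hc : Continuous h) (hb : ∀ t, |h t| ≤ C) (t : ℝ) :
    HasDerivAt (relaxation L h) (h t - L * relaxation L h t) t := by
  have hint := integrableOn_exp_mul_of_bounded hL hc hb
  have hcont : Continuous fun s => Real.exp (L * s) * h s := by fun_prop
  have heq : (fun t => ∫ s in Iic t, Real.exp (L * s) * h s) = fun t =>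
      (∫ s in (0 : ℝ)..t, Real.exp (L * s) * h s) + ∫ s in Iic 0, Real.exp (L * s) * h s := by
    funext t
    rw [← intervalIntegral.integral_Iic_sub_Iic (hint 0) (hint t), sub_add_cancel]
  have h1 : HasDerivAt (fun t => ∫ s in Iic t, Real.exp (L * s) * h s)
      (Real.exp (L * t) * h t) t := by
    rw [heq]
    exact (hcont.integral_hasStrictDerivAt 0 t).hasDerivAt.add_const _
  have h2 : HasDerivAt (fun t => Real.exp (-(L * t))) (Real.exp (-(L * t)) * -(L * 1)) t :=
    (((hasDerivAt_id t).const_mul L).fun_neg : HasDerivAt (fun t => -(L * t)) _ t).exp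
  refine (h2.mul h1).congr_deriv ?_
  have h3 : Real.exp (-(L * t)) * (Real.exp (L * t) * h t) = h t := by
    rw [← mul_assoc, ← Real.exp_add, neg_add_cancel, Real.exp_zero, one_mul]
  rw [h3, relaxation]
  ring

theorem abs_relaxation_le (hL : 0 < L) (hb : ∀ t, |h t| ≤ C) (t : ℝ) :
    |relaxation L h t| ≤ C / L := by
  have h1 : |∫ s in Iic t, Real.exp (L * s) * h s| ≤ ∫ s in Iic t, Real.exp (L * s) * C := by
    rw [← Real.norm_eq_abs]
    refine norm_integral_le_of_norm_le ((integrableOn_exp_mul_Iic hL t).mul_const C)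
      (Eventually.of_forall fun s => ?_)
    rw [Real.norm_eq_abs, abs_mul, Real.abs_exp]
    exact mul_le_mul_of_nonneg_left (hb s) (Real.exp_pos _).le
  rw [integral_mul_const, integral_exp_mul_Iic hL] at h1
  rw [relaxation, abs_mul, Real.abs_exp]
  refine (mul_le_mul_of_nonneg_left h1 (Real.exp_pos _).le).trans_eq ?_
  rw [Real.exp_neg]
  field_simp

theorem relaxation_sub (hL : 0 < L) {D : ℝ} (hc : Continuous h) (hb : ∀ t, |h t| ≤ C)
    (kc : Continuous k) (kb : ∀ t, |k t| ≤ D) (t : ℝ) :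
    relaxation L (fun s => h s - k s) t = relaxation L h t - relaxation L k t := by
  simp only [relaxation, mul_sub]
  rw [integral_sub (integrableOn_exp_mul_of_bounded hL hc hb t)
    (integrableOn_exp_mul_of_bounded hL kc kb t), mul_sub]

end relaxation

open BoundedContinuousFunction in
/-- If `x ↦ F t x` is strictly decreasing with slopes in `[-L, -δ]`, then `y' = F(t, y)` has a
bounded solution on the whole line. -/
theorem exists_bounded_solution {F : ℝ → ℝ → ℝ} {L δ C : ℝ} (hF : Continuous (Function.uncurry F))
    (hb : ∀ t, |F t 0| ≤ C) (hδ : 0 < δ) (hδL : δ ≤ L)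
    (hlip : ∀ t x y, |(F t x + L * x) - (F t y + L * y)| ≤ (L - δ) * |x - y|) :
    ∃ y : ℝ →ᵇ ℝ, ∀ t, HasDerivAt y (F t (y t)) t := by
  have hL : 0 < L := hδ.trans_le hδL
  have hLδ : 0 ≤ L - δ := sub_nonneg.2 hδL
  let h : (ℝ →ᵇ ℝ) → ℝ → ℝ := fun y t => F t (y t) + L * y t
  have hc : ∀ y, Continuous (h y) := fun y =>
    (hF.comp (continuous_id.prodMk y.continuous)).add (continuous_const.mul y.continuous)
  have hbd : ∀ y t, |h y t| ≤ (L - δ) * ‖y‖ + C := fun y t => by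
    have h1 := hlip t (y t) 0
    have h2 := mul_le_mul_of_nonneg_left (y.norm_coe_le_norm t) hLδ
    rw [Real.norm_eq_abs] at h2
    simp only [mul_zero, add_zero, sub_zero] at h1
    calc |h y t| = |(F t (y t) + L * y t - F t 0) + F t 0| := by rw [sub_add_cancel]
      _ ≤ |F t (y t) + L * y t - F t 0| + |F t 0| := abs_add_le _ _
      _ ≤ _ := add_le_add (h1.trans h2) (hb t)
  have hd : ∀ y t, HasDerivAt (relaxation L (h y)) (h y t - L * relaxation L (h y) t) t :=
    fun y t => hasDerivAt_relaxation hL (hc y) (hbd y) t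
  let Φ : (ℝ →ᵇ ℝ) → (ℝ →ᵇ ℝ) := fun y =>
    BoundedContinuousFunction.ofNormedAddCommGroup (relaxation L (h y))
      (continuous_of_forall_hasDerivAt (hd y)) _ (abs_relaxation_le hL (hbd y))
  have hΦ : ContractingWith (Real.toNNReal ((L - δ) / L)) Φ := by
    refine ⟨?_, LipschitzWith.of_dist_le_mul fun y z => ?_⟩
    · rw [Real.toNNReal_lt_one, div_lt_one hL]
      linarith
    · rw [Real.coe_toNNReal _ (by positivity),
        BoundedContinuousFunction.dist_le (by positivity)]
      intro t
      change |relaxation L (h y) t - relaxation L (h z) t| ≤ _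
      rw [← relaxation_sub hL (hc y) (hbd y) (hc z) (hbd z)]
      refine (abs_relaxation_le (C := (L - δ) * dist y z) hL (fun s => ?_) t).trans_eq (by ring)
      exact (hlip s _ _).trans (mul_le_mul_of_nonneg_left (dist_coe_le_dist (f := y) (g := z) s) hLδ)
  obtain ⟨y, hy⟩ : ∃ y, Φ y = y := ⟨_, hΦ.fixedPoint_isFixedPt⟩
  have hy' : relaxation L (h y) = y := congrArg DFunLike.coe hy
  refine ⟨y, fun t => ?_⟩
  have h1 := hd y t
  rw [hy'] at h1
  exact h1.congr_deriv (by simp only [h]; ring)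

/-- Two bounded solutions of a uniformly dissipative equation coincide. -/
theorem eq_of_bounded_solution {F : ℝ → ℝ → ℝ} {L δ C : ℝ} {y z : ℝ → ℝ} (hδ : 0 < δ)
    (hlip : ∀ t x y, |(F t x + L * x) - (F t y + L * y)| ≤ (L - δ) * |x - y|)
    (hy : ∀ t, HasDerivAt y (F t (y t)) t) (hz : ∀ t, HasDerivAt z (F t (z t)) t)
    (hb : ∀ t, |y t - z t| ≤ C) : y = z := by
  have hdiss : ∀ t, (y t - z t) * (F t (y t) - F t (z t)) ≤ -δ * (y t - z t) ^ 2 := fun t => by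
    have h1 := mul_le_mul_of_nonneg_left (hlip t (y t) (z t)) (abs_nonneg (y t - z t))
    rw [← abs_mul] at h1
    have h2 := (le_abs_self _).trans h1
    linear_combination h2 + (L - δ) * abs_mul_abs_self (y t - z t)
  have hanti : Antitone fun t => (y t - z t) ^ 2 * Real.exp (2 * δ * t) := by
    refine antitone_of_hasDerivAt_nonpos
      (f' := fun t => (2 * ((y t - z t) * (F t (y t) - F t (z t))) + 2 * δ * (y t - z t) ^ 2) *
        Real.exp (2 * δ * t)) (fun t => ?_) fun t => ?_
    · refine ((((hy t).sub (hz t)).fun_pow 2).mul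
        ((hasDerivAt_id t).const_mul (2 * δ)).exp).congr_deriv ?_
      simp only [Pi.sub_apply, id]
      push_cast
      ring
    · exact mul_nonpos_of_nonpos_of_nonneg (by linarith [hdiss t]) (Real.exp_pos _).le
  funext t
  by_contra hne
  have hpos : 0 < (y t - z t) ^ 2 := by
    have := sub_ne_zero.2 hne
    positivity
  set c := (y t - z t) ^ 2 with hc
  have hx : 0 ≤ C ^ 2 / c / (2 * δ) := by positivity
  set x := C ^ 2 / c / (2 * δ) with hxdef
  have h1 : c * Real.exp (2 * δ * t) ≤
      (y (t - x) - z (t - x)) ^ 2 * Real.exp (2 * δ * (t - x)) := hanti (by linarith)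
  have h2 : (y (t - x) - z (t - x)) ^ 2 ≤ C ^ 2 := sq_le_sq' (by linarith [abs_le.1 (hb (t - x))])
    (abs_le.1 (hb (t - x))).2
  have h3 : Real.exp (2 * δ * t) = Real.exp (2 * δ * x) * Real.exp (2 * δ * (t - x)) := by
    rw [← Real.exp_add]
    ring_nf
  rw [h3, ← mul_assoc] at h1
  have h4 := (le_of_mul_le_mul_right h1 (Real.exp_pos _)).trans h2
  have h5 := mul_le_mul_of_nonneg_left (Real.add_one_le_exp (2 * δ * x)) hpos.le
  have h6 : c * (2 * δ * x) = C ^ 2 := by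
    rw [hxdef]
    field_simp
  linarith

/-- A uniformly dissipative equation with periodic coefficients has a periodic solution. -/
theorem exists_periodic_solution {F : ℝ → ℝ → ℝ} {L δ T : ℝ}
    (hF : Continuous (Function.uncurry F)) (hT : 0 < T) (hper : ∀ t x, F (t + T) x = F t x)
    (hδ : 0 < δ) (hδL : δ ≤ L)
    (hlip : ∀ t x y, |(F t x + L * x) - (F t y + L * y)| ≤ (L - δ) * |x - y|) :
    ∃ y : ℝ → ℝ, Function.Periodic y T ∧ ∀ t, HasDerivAt y (F t (y t)) t := by
  have hF0 : Continuous fun t => |F t 0| :=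
    (hF.comp (continuous_id.prodMk continuous_const)).abs
  obtain ⟨s, hs⟩ := exists_forall_le_of_periodic (u := fun t => |F t 0|) hT
    (fun t => by simp only [hper]) hF0
  obtain ⟨y, hy⟩ := exists_bounded_solution hF hs hδ hδL hlip
  refine ⟨y, fun t => ?_, hy⟩
  refine congrFun (eq_of_bounded_solution (C := 2 * ‖y‖) (y := fun t => y (t + T)) hδ hlip
    (fun t => ?_) hy fun t => ?_) t
  · exact ((hy (t + T)).comp_add_const t T).congr_deriv (hper _ _)
  · have h1 := y.dist_le_two_norm (t + T) t
    rwa [Real.dist_eq] at h1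

/-! ### The nonlinearity -/

namespace IsCrackLaw

variable {f : ℝ → ℝ} {fmin : EReal} {x y m M : ℝ}

theorem hasDerivAt (hf : IsCrackLaw f fmin) (hy : -1 < y) : HasDerivAt f (deriv f y) y :=
  (differentiableAt_of_deriv_ne_zero (hf.deriv_neg y hy).ne).hasDerivAt

theorem hasDerivAt_deriv (hf : IsCrackLaw f fmin) (hy : -1 < y) :
    HasDerivAt (deriv f) (deriv (deriv f) y) y :=
  (differentiableAt_of_deriv_ne_zero (hf.deriv_deriv_pos y hy).ne').hasDerivAt

theorem continuousOn (hf : IsCrackLaw f fmin) : ContinuousOn f (Ioi (-1)) := fun _ hy =>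
  (hf.hasDerivAt hy).continuousAt.continuousWithinAt

theorem continuousOn_deriv (hf : IsCrackLaw f fmin) : ContinuousOn (deriv f) (Ioi (-1)) :=
  fun _ hy => (hf.hasDerivAt_deriv hy).continuousAt.continuousWithinAt

theorem strictMonoOn_deriv (hf : IsCrackLaw f fmin) : StrictMonoOn (deriv f) (Ioi (-1)) :=
  strictMonoOn_of_deriv_pos (convex_Ioi _) hf.continuousOn_deriv fun y hy =>
    hf.deriv_deriv_pos y (by rwa [interior_Ioi] at hy)

theorem strictAntiOn (hf : IsCrackLaw f fmin) : StrictAntiOn f (Ioi (-1)) :=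
  strictAntiOn_of_deriv_neg (convex_Ioi _) hf.continuousOn fun y hy =>
    hf.deriv_neg y (by rwa [interior_Ioi] at hy)

theorem neg_of_pos (hf : IsCrackLaw f fmin) (hy : 0 < y) : f y < 0 := by
  rw [← hf.map_zero]
  exact hf.strictAntiOn (by norm_num) (by rw [mem_Ioi]; linarith) hy

theorem exists_deriv_mul (hf : IsCrackLaw f fmin) (hx : -1 < x) (hxy : x < y) :
    ∃ ξ ∈ Ioo x y, f y - f x = deriv f ξ * (y - x) := by
  obtain ⟨ξ, hξ, h⟩ := exists_hasDerivAt_eq_slope f (deriv f) hxy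
    (hf.continuousOn.mono fun z hz => hx.trans_le hz.1)
    fun z hz => hf.hasDerivAt (hx.trans hz.1)
  refine ⟨ξ, hξ, ?_⟩
  rw [h, div_mul_cancel₀ _ (sub_ne_zero.2 hxy.ne')]

theorem tangent_lt (hf : IsCrackLaw f fmin) (hx : -1 < x) (hy : -1 < y) (hxy : x ≠ y) :
    f y + deriv f y * (x - y) < f x := by
  rcases hxy.lt_or_gt with h | h
  · obtain ⟨ξ, hξ, h1⟩ := hf.exists_deriv_mul hx h
    have h2 := mul_lt_mul_of_pos_right
      (hf.strictMonoOn_deriv (hx.trans hξ.1 : -1 < ξ) hy hξ.2) (sub_pos.2 h)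
    linarith
  · obtain ⟨ξ, hξ, h1⟩ := hf.exists_deriv_mul hy h
    have h2 := mul_lt_mul_of_pos_right
      (hf.strictMonoOn_deriv hy (hy.trans hξ.1 : -1 < ξ) hξ.1) (sub_pos.2 h)
    linarith

theorem exists_dslope_eq (hf : IsCrackLaw f fmin) (hm : -1 < m) (hx : x ∈ Icc m M)
    (hy : y ∈ Icc m M) : ∃ ξ ∈ Icc m M, dslope f y x = deriv f ξ := by
  rcases lt_trichotomy x y with h | rfl | h
  · obtain ⟨ξ, hξ, h1⟩ := hf.exists_deriv_mul (hm.trans_le hx.1) h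
    refine ⟨ξ, ⟨hx.1.trans hξ.1.le, hξ.2.le.trans hy.2⟩, ?_⟩
    have h2 := sub_smul_dslope f y x
    rw [smul_eq_mul] at h2
    exact mul_left_cancel₀ (sub_ne_zero.2 h.ne) (by linarith)
  · exact ⟨x, hx, dslope_same f x⟩
  · obtain ⟨ξ, hξ, h1⟩ := hf.exists_deriv_mul (hm.trans_le hy.1) h
    refine ⟨ξ, ⟨hy.1.trans hξ.1.le, hξ.2.le.trans hx.2⟩, ?_⟩
    have h2 := sub_smul_dslope f y x
    rw [smul_eq_mul] at h2
    exact mul_left_cancel₀ (sub_ne_zero.2 h.ne') (by linarith)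

theorem deriv_mem_Icc (hf : IsCrackLaw f fmin) (hm : -1 < m) (hx : x ∈ Icc m M) :
    deriv f x ∈ Icc (deriv f m) (deriv f M) :=
  ⟨hf.strictMonoOn_deriv.monotoneOn hm (hm.trans_le hx.1) hx.1,
    hf.strictMonoOn_deriv.monotoneOn (hm.trans_le hx.1) (hm.trans_le (hx.1.trans hx.2)) hx.2⟩

theorem dslope_mem_Icc (hf : IsCrackLaw f fmin) (hm : -1 < m) (hx : x ∈ Icc m M)
    (hy : y ∈ Icc m M) : dslope f y x ∈ Icc (deriv f m) (deriv f M) := by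
  obtain ⟨ξ, hξ, h⟩ := hf.exists_dslope_eq hm hx hy
  rw [h]
  exact hf.deriv_mem_Icc hm hξ

theorem dslope_neg (hf : IsCrackLaw f fmin) (hx : -1 < x) (hy : -1 < y) : dslope f y x < 0 := by
  obtain ⟨ξ, hξ, h⟩ := hf.exists_dslope_eq (lt_min hx hy) ⟨min_le_left x y, le_max_left x y⟩
    ⟨min_le_right x y, le_max_right x y⟩
  rw [h]
  exact hf.deriv_neg ξ ((lt_min hx hy).trans_le hξ.1)

theorem continuousOn_dslope_zero (hf : IsCrackLaw f fmin) :
    ContinuousOn (dslope f 0) (Ioi (-1)) :=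
  (continuousOn_dslope (Ioi_mem_nhds (by norm_num))).2
    ⟨hf.continuousOn, (hf.hasDerivAt (by norm_num)).differentiableAt⟩

theorem eq_dslope_zero_mul (hf : IsCrackLaw f fmin) (y : ℝ) : f y = dslope f 0 y * y := by
  have h := sub_smul_dslope f 0 y
  rw [hf.map_zero, smul_eq_mul] at h
  linarith

/-- Quadratic remainder of the first order Taylor expansion on a compact interval. -/
theorem exists_abs_remainder_le (hf : IsCrackLaw f fmin) (hm : -1 < m) (M : ℝ) :
    ∃ K, 0 ≤ K ∧ ∀ x ∈ Icc m M, ∀ y ∈ Icc m M,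
      |f x - f y - deriv f y * (x - y)| ≤ K * (x - y) ^ 2 := by
  have hsub : Icc m M ⊆ Ioi (-1) := fun z hz => hm.trans_le hz.1
  have hc : ContinuousOn (deriv (deriv f)) (Ioi (-1)) :=
    ((hf.contDiffOn.deriv_of_isOpen isOpen_Ioi (m := 1) (by norm_num)).continuousOn_deriv_of_isOpen
      isOpen_Ioi le_rfl)
  obtain ⟨K, hK⟩ := isCompact_Icc.exists_bound_of_continuousOn (hc.mono hsub)
  refine ⟨|K|, abs_nonneg _, fun x hx y hy => ?_⟩
  obtain ⟨ξ, hξ, h⟩ := hf.exists_dslope_eq (lt_min (hsub hx) (hsub hy))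
    ⟨min_le_left x y, le_max_left x y⟩ ⟨min_le_right x y, le_max_right x y⟩
  have hξ' : ξ ∈ Icc m M := ⟨(le_min hx.1 hy.1).trans hξ.1, hξ.2.trans (max_le hx.2 hy.2)⟩
  have h1 : f x - f y - deriv f y * (x - y) = (deriv f ξ - deriv f y) * (x - y) := by
    rw [← sub_smul_dslope, h, smul_eq_mul]
    ring
  have h2 := (convex_Icc m M).norm_image_sub_le_of_norm_deriv_le
    (fun z hz => (hf.hasDerivAt_deriv (hsub hz)).differentiableAt)
    (fun z hz => (hK z hz).trans (le_abs_self K)) hy hξ'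
  have h3 : |ξ - y| ≤ |x - y| := by
    have := abs_sub_left_of_mem_uIcc (a := y) (b := x) (c := ξ) (by rw [uIcc_comm]; exact hξ)
    exact this
  rw [h1, abs_mul, ← sq_abs (x - y), pow_two, ← mul_assoc]
  exact mul_le_mul_of_nonneg_right
    (h2.trans (mul_le_mul_of_nonneg_left h3 (abs_nonneg _))) (abs_nonneg _)

theorem exists_lt_apply (hf : IsCrackLaw f fmin) (A : ℝ) : ∃ m, -1 < m ∧ m < 0 ∧ A ≤ f m := by
  have h1 : ∀ᶠ y in 𝓝[>] (-1 : ℝ), A ≤ f y := hf.tendsto_atTop.eventually_ge_atTop A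
  have h2 : ∀ᶠ y in 𝓝[>] (-1 : ℝ), y ∈ Ioo (-1 : ℝ) 0 := Ioo_mem_nhdsGT (by norm_num)
  obtain ⟨m, h3, h4⟩ := (h1.and h2).exists
  exact ⟨m, h4.1, h4.2, h3⟩

end IsCrackLaw

/-! ### Existence and uniqueness of the periodic solution -/

section

variable {f : ℝ → ℝ} {fmin : EReal} {ω A : ℝ} {y z : ℝ → ℝ}

/-- A priori bounds, from the constant lower barrier `m` and the upper barrier
`(A / ω) (1 - cos ωt)`. -/
theorem mem_Icc_of_periodic_of_hasDerivAt {g : ℝ → ℝ} {m : ℝ} (hω : 0 < ω) (hA : 0 < A)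
    (hy : ∀ t, HasDerivAt y (g (y t) + A * Real.sin (ω * t)) t)
    (hper : Function.Periodic y (forcingPeriod ω))
    (hm : ∀ t, y t < m → A < g (y t)) (hpos : ∀ t, 0 < y t → g (y t) < 0) (t : ℝ) :
    y t ∈ Icc m (2 * A / ω) := by
  have hT := forcingPeriod_pos hω
  have hA' : ∀ s, -A ≤ A * Real.sin (ω * s) := fun s => by
    nlinarith [Real.neg_one_le_sin (ω * s)]
  have hAω : 0 < A / ω := by positivity
  constructor
  · obtain ⟨s, hs⟩ := exists_forall_ge_of_periodic hT hper (continuous_of_forall_hasDerivAt hy)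
    have h0 := (hy s).eq_zero_of_forall_ge hs
    by_contra! hlt
    linarith [hm s ((hs t).trans_lt hlt), hA' s]
  · have hd : ∀ t, HasDerivAt (fun t => y t + A / ω * Real.cos (ω * t)) (g (y t)) t := fun t => by
      refine ((hy t).add (((hasDerivAt_id t).const_mul ω).cos.const_mul (A / ω))).congr_deriv ?_
      simp only [id]
      field_simp
      ring
    have hp : Function.Periodic (fun t => y t + A / ω * Real.cos (ω * t)) (forcingPeriod ω) :=
      fun t => by
        simp only [hper t, mul_add, mul_forcingPeriod hω, Real.cos_add_two_pi]
    obtain ⟨s, hs⟩ := exists_forall_le_of_periodic hT hp (continuous_of_forall_hasDerivAt hd)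
    have h0 := (hd s).eq_zero_of_forall_le hs
    have h1 : y s ≤ 0 := not_lt.1 fun h => (hpos s h).ne h0
    have h2 := hs t
    have h3 := mul_le_mul_of_nonneg_left (Real.cos_le_one (ω * s)) hAω.le
    have h4 := mul_le_mul_of_nonneg_left (Real.neg_one_le_cos (ω * t)) hAω.le
    have h5 : 2 * A / ω = 2 * (A / ω) := by ring
    linarith

theorem IsPeriodicSolution.mem_Icc {m : ℝ} (hy : IsPeriodicSolution f ω A y)
    (hf : IsCrackLaw f fmin) (hω : 0 < ω) (hA : 0 < A) (hm : -1 < m) (hAm : A ≤ f m) (t : ℝ) :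
    y t ∈ Icc m (2 * A / ω) :=
  mem_Icc_of_periodic_of_hasDerivAt hω hA hy.hasDerivAt hy.periodic
    (fun t ht => hAm.trans_lt (hf.strictAntiOn (hy.gt_neg_one t) hm ht))
    (fun _ ht => hf.neg_of_pos ht) t

theorem IsPeriodicSolution.continuous (hy : IsPeriodicSolution f ω A y) : Continuous y :=
  continuous_of_forall_hasDerivAt hy.hasDerivAt

theorem IsPeriodicSolution.eq (hy : IsPeriodicSolution f ω A y) (hz : IsPeriodicSolution f ω A z)
    (hf : IsCrackLaw f fmin) (hω : 0 < ω) : y = z := by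
  have key : ∀ {y z : ℝ → ℝ}, IsPeriodicSolution f ω A y → IsPeriodicSolution f ω A z →
      ∀ t, 0 ≤ y t - z t := fun {y z} hy hz t =>
    nonneg_of_periodic_of_hasDerivAt (u := fun t => y t - z t)
      (q := fun t => dslope f (z t) (y t)) (r := fun _ => 0) (forcingPeriod_pos hω)
      (hy.periodic.sub hz.periodic)
      (fun t => ((hy.hasDerivAt t).sub (hz.hasDerivAt t)).congr_deriv (by
        have := sub_smul_dslope f (z t) (y t)
        rw [smul_eq_mul] at this
        linarith))
      (fun t => hf.dslope_neg (hy.gt_neg_one t) (hz.gt_neg_one t)) (fun _ => le_rfl) t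
  funext t
  linarith [key hy hz t, key hz hy t]

/-- `f` on `[m, M]`, continued by straight lines of slope `-1`. -/
noncomputable def lineExtension (f : ℝ → ℝ) (m M y : ℝ) : ℝ :=
  f (max m (min M y)) - (y - max m (min M y))

theorem lineExtension_slope {m M : ℝ} (hf : IsCrackLaw f fmin) (hm : -1 < m) (hmM : m ≤ M)
    (x y : ℝ) :
    |(lineExtension f m M x + max (-deriv f m) 1 * x) -
      (lineExtension f m M y + max (-deriv f m) 1 * y)| ≤
      (max (-deriv f m) 1 - min (-deriv f M) 1) * |x - y| := by
  wlog hxy : y ≤ x generalizing x y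
  · have := this y x (le_of_not_ge hxy)
    rwa [abs_sub_comm, abs_sub_comm y x] at this
  have hL1 := le_max_left (-deriv f m) 1
  have hL2 := le_max_right (-deriv f m) 1
  have hδ1 := min_le_left (-deriv f M) 1
  have hδ2 := min_le_right (-deriv f M) 1
  set L := max (-deriv f m) 1
  set δ := min (-deriv f M) 1
  have hab : max m (min M y) ≤ max m (min M x) := max_le_max le_rfl (min_le_min le_rfl hxy)
  have hxy' : y - max m (min M y) ≤ x - max m (min M x) := by
    rcases max_cases m (min M y) with h1 | h1 <;> rcases max_cases m (min M x) with h2 | h2 <;>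
    rcases min_cases M y with h3 | h3 <;> rcases min_cases M x with h4 | h4 <;> linarith
  have hax : max m (min M x) ∈ Icc m M := ⟨le_max_left _ _, max_le hmM (min_le_left _ _)⟩
  have hay : max m (min M y) ∈ Icc m M := ⟨le_max_left _ _, max_le hmM (min_le_left _ _)⟩
  have hs := hf.dslope_mem_Icc hm hax hay
  have he := sub_smul_dslope f (max m (min M y)) (max m (min M x))
  rw [smul_eq_mul] at he
  simp only [lineExtension]
  set a := max m (min M y)
  set b := max m (min M x)
  have h1 := mul_le_mul_of_nonneg_left hs.1 (sub_nonneg.2 hab)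
  have h2 := mul_le_mul_of_nonneg_left hs.2 (sub_nonneg.2 hab)
  have h3 := mul_le_mul_of_nonneg_right hL1 (sub_nonneg.2 hab)
  have h4 := mul_le_mul_of_nonneg_right hδ1 (sub_nonneg.2 hab)
  have h5 := mul_le_mul_of_nonneg_right hL2 (sub_nonneg.2 hxy')
  have h6 := mul_le_mul_of_nonneg_right hδ2 (sub_nonneg.2 hxy')
  rw [abs_of_nonneg (sub_nonneg.2 hxy), abs_le]
  constructor <;> nlinarith

theorem exists_isPeriodicSolution (hf : IsCrackLaw f fmin) (hω : 0 < ω) (hA : 0 < A) :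
    ∃ y, IsPeriodicSolution f ω A y := by
  obtain ⟨m, hm, hm0, hAm⟩ := hf.exists_lt_apply A
  have hM : 0 < 2 * A / ω := by positivity
  set M := 2 * A / ω with hMdef
  have hclamp : Continuous fun y : ℝ => max m (min M y) := by fun_prop
  have hcont : Continuous (lineExtension f m M) :=
    (hf.continuousOn.comp_continuous hclamp fun y => hm.trans_le (le_max_left _ _)).sub
      (continuous_id.sub hclamp)
  obtain ⟨y, hper, hy⟩ := exists_periodic_solution
    (F := fun t x => lineExtension f m M x + A * Real.sin (ω * t))
    (L := max (-deriv f m) 1) (δ := min (-deriv f M) 1)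
    (by
      have := hcont.comp (continuous_snd (X := ℝ))
      unfold Function.uncurry
      fun_prop)
    (forcingPeriod_pos hω)
    (fun t x => by
      have := periodic_sin_mul hω t
      simp only at this
      simp only [this])
    (lt_min (by linarith [hf.deriv_neg M (by linarith)]) one_pos)
    ((min_le_right _ _).trans (le_max_right _ _))
    (fun t x y => by
      refine le_trans (le_of_eq ?_) (lineExtension_slope hf hm (hm0.le.trans hM.le) x y)
      congr 1
      ring)
  have hmem := mem_Icc_of_periodic_of_hasDerivAt (m := m) hω hA hy hper
    (fun t ht => by
      rw [lineExtension, max_eq_left ((min_le_right _ _).trans ht.le)]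
      linarith)
    (fun t ht => by
      have h1 : 0 < min M (y t) := lt_min hM ht
      rw [lineExtension, max_eq_right (hm0.le.trans h1.le)]
      linarith [hf.neg_of_pos h1, min_le_right M (y t)])
  refine ⟨y, fun t => hm.trans_le (hmem t).1, fun t => (hy t).congr_deriv ?_, hper⟩
  rw [lineExtension, min_eq_right (hmem t).2, max_eq_right (hmem t).1, sub_self, sub_zero]

/-! ### Dependence on the amplitude -/

theorem exists_sensitivity (hf : IsCrackLaw f fmin) (hω : 0 < ω) (hA : 0 < A)
    (hy : IsPeriodicSolution f ω A y) :
    ∃ z : ℝ → ℝ, Function.Periodic z (forcingPeriod ω) ∧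
      (∀ t, HasDerivAt z (deriv f (y t) * z t + Real.sin (ω * t)) t) ∧
      ∃ C, ∀ a, 0 < a → a < A + 1 → ∀ x, IsPeriodicSolution f ω a x →
        ∀ t, |x t - y t - (a - A) * z t| ≤ C * (a - A) ^ 2 := by
  have hT := forcingPeriod_pos hω
  obtain ⟨m, hm, hm0, hAm⟩ := hf.exists_lt_apply (A + 1)
  have hM : 0 < 2 * (A + 1) / ω := by positivity
  set M := 2 * (A + 1) / ω with hMdef
  have hbound : ∀ a, 0 < a → a < A + 1 → ∀ x, IsPeriodicSolution f ω a x → ∀ t, x t ∈ Icc m M :=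
    fun a h0 h1 x hx t => by
      obtain ⟨h2, h3⟩ := hx.mem_Icc hf hω h0 hm (h1.le.trans hAm) t
      refine ⟨h2, h3.trans ?_⟩
      rw [hMdef]
      gcongr
  have hyM := hbound A hA (by linarith) y hy
  set δ := -deriv f M with hδdef
  have hδ : 0 < δ := neg_pos.2 (hf.deriv_neg M (by linarith))
  have hq : ∀ t, deriv f (y t) ∈ Icc (deriv f m) (deriv f M) := fun t =>
    hf.deriv_mem_Icc hm (hyM t)
  have hqc : Continuous fun t => deriv f (y t) :=
    hf.continuousOn_deriv.comp_continuous hy.continuous hy.gt_neg_one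
  obtain ⟨z, hzper, hz⟩ := exists_periodic_solution
    (F := fun t x => deriv f (y t) * x + Real.sin (ω * t))
    (L := -deriv f m) (δ := δ) (T := forcingPeriod ω)
    (by
      have := hqc.comp (continuous_fst (Y := ℝ))
      unfold Function.uncurry
      fun_prop)
    hT
    (fun t x => by
      have := periodic_sin_mul hω t
      simp only at this
      simp only [this, hy.periodic t])
    hδ (neg_le_neg ((hq 0).1.trans (hq 0).2))
    (fun t x y' => by
      have h1 : deriv f (y t) * x + Real.sin (ω * t) + -deriv f m * x -
          (deriv f (y t) * y' + Real.sin (ω * t) + -deriv f m * y') =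
          (deriv f (y t) - deriv f m) * (x - y') := by ring
      rw [h1, abs_mul, abs_of_nonneg (sub_nonneg.2 (hq t).1)]
      exact mul_le_mul_of_nonneg_right (by linarith [(hq t).2]) (abs_nonneg _))
  obtain ⟨K, hK0, hK⟩ := hf.exists_abs_remainder_le hm M
  refine ⟨z, hzper, hz, K / δ ^ 2 / δ, fun a ha0 ha1 x hx t => ?_⟩
  have hxM := hbound a ha0 ha1 x hx
  have hlip : ∀ t, |x t - y t| ≤ |a - A| / δ := fun t =>
    abs_le_of_periodic_of_hasDerivAt (u := fun t => x t - y t)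
      (q := fun t => dslope f (y t) (x t)) (r := fun t => (a - A) * Real.sin (ω * t)) hT
      (hx.periodic.sub hy.periodic)
      (fun t => ((hx.hasDerivAt t).sub (hy.hasDerivAt t)).congr_deriv (by
        have := sub_smul_dslope f (y t) (x t)
        rw [smul_eq_mul] at this
        linarith))
      hδ (fun t => by linarith [(hf.dslope_mem_Icc hm (hxM t) (hyM t)).2])
      (fun t => by
        rw [abs_mul]
        exact mul_le_of_le_one_right (abs_nonneg _) (Real.abs_sin_le_one _)) t
  have h := abs_le_of_periodic_of_hasDerivAt (u := fun t => x t - y t - (a - A) * z t)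
      (q := fun t => deriv f (y t))
      (r := fun t => f (x t) - f (y t) - deriv f (y t) * (x t - y t))
      (ε := K * (|a - A| / δ) ^ 2) hT
      (fun t => by simp only [hx.periodic t, hy.periodic t, hzper t])
      (fun t => (((hx.hasDerivAt t).sub (hy.hasDerivAt t)).sub
        ((hz t).const_mul (a - A))).congr_deriv (by ring))
      hδ (fun t => by linarith [(hq t).2])
      (fun t => (hK _ (hxM t) _ (hyM t)).trans (by
        refine mul_le_mul_of_nonneg_left ?_ hK0
        rw [← sq_abs]
        gcongr
        exact hlip t)) t
  refine h.trans_eq ?_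
  rw [div_pow, sq_abs]
  ring

end

section

variable {f : ℝ → ℝ} {fmin : EReal} {ω A : ℝ} {y z : ℝ → ℝ}

theorem hasDerivAt_of_abs_sub_le_sq {g : ℝ → ℝ} {g' a C : ℝ}
    (h : ∀ᶠ x in 𝓝 a, |g x - g a - (x - a) * g'| ≤ C * (x - a) ^ 2) : HasDerivAt g g' a := by
  rw [hasDerivAt_iff_isLittleO]
  refine Asymptotics.IsBigO.trans_isLittleO (Asymptotics.IsBigO.of_bound C ?_)
    (Asymptotics.isLittleO_pow_sub_sub a one_lt_two)
  filter_upwards [h] with x hx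
  simpa using hx

/-- The derivative of a root of `Y a` with respect to the parameter `a`. -/
theorem hasDerivAt_root {Y : ℝ → ℝ → ℝ} {τ : ℝ → ℝ} {y' C : ℝ}
    (hlin : ∀ᶠ a in 𝓝 A, ∀ t, |Y a t - Y A t - (a - A) * z t| ≤ C * (a - A) ^ 2)
    (hz : ContinuousAt z (τ A)) (hy : HasDerivAt (Y A) y' (τ A)) (hy' : y' ≠ 0)
    (hτ : ContinuousAt τ A) (hroot : ∀ᶠ a in 𝓝 A, Y a (τ a) = 0) :
    HasDerivAt τ (-z (τ A) / y') A := by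
  set S : ℝ → ℝ := fun a => dslope (Y A) (τ A) (τ a) with hS
  set e : ℝ → ℝ := fun a => (Y a (τ a) - Y A (τ a) - (a - A) * z (τ a)) / (a - A) with he
  have hSt : Tendsto S (𝓝 A) (𝓝 y') := by
    have h1 : ContinuousAt (dslope (Y A) (τ A)) (τ A) :=
      continuousAt_dslope_same.2 hy.differentiableAt
    have h2 := h1.tendsto.comp hτ.tendsto
    rwa [dslope_same, hy.deriv] at h2
  have het : Tendsto e (𝓝[≠] A) (𝓝 0) := by
    have h1 : Tendsto (fun a => C * |a - A|) (𝓝[≠] A) (𝓝 0) := by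
      have : Continuous fun a => C * |a - A| := by fun_prop
      have h2 := this.tendsto A
      simp only [sub_self, abs_zero, mul_zero] at h2
      exact h2.mono_left nhdsWithin_le_nhds
    refine squeeze_zero_norm' ?_ h1
    filter_upwards [hlin.filter_mono nhdsWithin_le_nhds, self_mem_nhdsWithin] with a ha hne
    have hpos : 0 < |a - A| := abs_pos.2 (sub_ne_zero.2 hne)
    rw [Real.norm_eq_abs, abs_div, div_le_iff₀ hpos]
    refine (ha (τ a)).trans_eq ?_
    rw [← sq_abs]
    ring
  rw [hasDerivAt_iff_tendsto_slope]
  have hzt : Tendsto (fun a => z (τ a)) (𝓝[≠] A) (𝓝 (z (τ A))) :=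
    (hz.tendsto.comp hτ.tendsto).mono_left nhdsWithin_le_nhds
  have hlim := ((hzt.add het).neg).div (hSt.mono_left nhdsWithin_le_nhds) hy'
  rw [add_zero] at hlim
  refine hlim.congr' ?_
  filter_upwards [hroot.filter_mono nhdsWithin_le_nhds, self_mem_nhdsWithin,
    (hSt.eventually_ne hy').filter_mono nhdsWithin_le_nhds] with a ha hne hSa
  have hne' : a - A ≠ 0 := sub_ne_zero.2 hne
  have h1 := sub_smul_dslope (Y A) (τ A) (τ a)
  rw [smul_eq_mul, hroot.self_of_nhds, sub_zero] at h1
  simp only [slope_def_field, he, ha, Pi.div_apply]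
  rw [← h1]
  change -(z (τ a) + (0 - (τ a - τ A) * S a - (a - A) * z (τ a)) / (a - A)) / S a = _
  field_simp
  ring

theorem continuousAt_left_root {Y : ℝ → ℝ → ℝ} {τ₁ τ₂ : ℝ → ℝ} {T : ℝ}
    (hY : ∀ t, ContinuousAt (fun a => Y a t) A)
    (h : ∀ᶠ a in 𝓝 A, IsNegPosNeg (Y a) T (τ₁ a) (τ₂ a)) : ContinuousAt τ₁ A := by
  have hA := h.self_of_nhds
  have h1 := hA.pos_left
  have h2 := hA.left_lt
  have h3 := hA.lt_right
  have h4 := hA.right_lt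
  refine tendsto_order.2 ⟨fun b hb => ?_, fun b hb => ?_⟩
  · have hneg := hA.neg_of_lt (max b 0) (le_max_right _ _) (max_lt hb h1)
    filter_upwards [h, (hY (max b 0)).eventually_lt_const hneg] with a ha hlt
    by_contra! hle
    have hb0 : b < T / 2 := hb.trans h2
    have ha1 := ha.pos_left
    have ha2 := ha.lt_right
    have hmax : max b 0 = b := max_eq_left (ha1.le.trans hle)
    rw [hmax] at hlt
    rcases hle.eq_or_lt with heq | hlt'
    · exact hlt.ne (heq ▸ ha.left_eq)
    · exact hlt.not_gt (ha.pos_of_mem b hlt' (hb0.trans ha2))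
  · have hpos := hA.pos_of_mem (min b (T / 2)) (lt_min hb h2) ((min_le_right _ _).trans_lt h3)
    filter_upwards [h, (hY (min b (T / 2))).eventually_const_lt hpos] with a ha hlt
    exact (ha.mem_Ioo_of_pos (le_min (by linarith) (by linarith))
      ((min_le_right _ _).trans (by linarith)) hlt).1.trans_le (min_le_left _ _)

theorem continuousAt_right_root {Y : ℝ → ℝ → ℝ} {τ₁ τ₂ : ℝ → ℝ} {T : ℝ}
    (hY : ∀ t, ContinuousAt (fun a => Y a t) A)
    (h : ∀ᶠ a in 𝓝 A, IsNegPosNeg (Y a) T (τ₁ a) (τ₂ a)) : ContinuousAt τ₂ A := by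
  have hA := h.self_of_nhds
  have h1 := hA.pos_left
  have h2 := hA.left_lt
  have h3 := hA.lt_right
  have h4 := hA.right_lt
  refine tendsto_order.2 ⟨fun b hb => ?_, fun b hb => ?_⟩
  · have hpos := hA.pos_of_mem (max b (T / 2)) (h2.trans_le (le_max_right _ _)) (max_lt hb h3)
    filter_upwards [h, (hY (max b (T / 2))).eventually_const_lt hpos] with a ha hlt
    exact (le_max_left _ _).trans_lt (ha.mem_Ioo_of_pos (le_trans (by linarith) (le_max_right _ _))
      (max_le (by linarith) (by linarith)) hlt).2
  · have hneg := hA.neg_of_gt (min b T) (lt_min hb h4) (min_le_right _ _)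
    filter_upwards [h, (hY (min b T)).eventually_lt_const hneg] with a ha hlt
    by_contra! hle
    have hb0 : T / 2 < b := h3.trans hb
    have ha1 := ha.left_lt
    have ha2 := ha.right_lt
    have hmin : min b T = b := min_eq_left (hle.trans ha2.le)
    rw [hmin] at hlt
    rcases hle.eq_or_lt with heq | hlt'
    · exact hlt.ne (heq ▸ ha.right_eq)
    · exact hlt.not_gt (ha.pos_of_mem b (ha1.trans hb0) hlt')

namespace IsPeriodicSolution

theorem exists_isNegPosNeg (hy : IsPeriodicSolution f ω A y) (hf : IsCrackLaw f fmin)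
    (hω : 0 < ω) (hA : 0 < A) : ∃ t₁ t₂, IsNegPosNeg y (forcingPeriod ω) t₁ t₂ :=
  _root_.exists_isNegPosNeg (q := fun t => dslope f 0 (y t)) hω hA hy.periodic
    (fun t => (hy.hasDerivAt t).congr_deriv (by rw [← hf.eq_dslope_zero_mul]))
    (hf.continuousOn_dslope_zero.comp_continuous hy.continuous hy.gt_neg_one)
    fun t => hf.dslope_neg (hy.gt_neg_one t) (by norm_num)

theorem exists_neg (hy : IsPeriodicSolution f ω A y) (hf : IsCrackLaw f fmin)
    (hω : 0 < ω) (hA : 0 < A) : ∃ t, y t < 0 := by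
  obtain ⟨t₁, t₂, h⟩ := hy.exists_isNegPosNeg hf hω hA
  exact ⟨0, h.neg_of_lt 0 le_rfl h.pos_left⟩

theorem continuous_deriv_comp (hy : IsPeriodicSolution f ω A y) (hf : IsCrackLaw f fmin) :
    Continuous fun t => deriv f (y t) :=
  hf.continuousOn_deriv.comp_continuous hy.continuous hy.gt_neg_one

/-- Convexity of `f` makes the solution superlinear in the amplitude. -/
theorem div_lt_sensitivity (hy : IsPeriodicSolution f ω A y) (hf : IsCrackLaw f fmin)
    (hω : 0 < ω) (hA : 0 < A) (hzper : Function.Periodic z (forcingPeriod ω))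
    (hz : ∀ t, HasDerivAt z (deriv f (y t) * z t + Real.sin (ω * t)) t) (t : ℝ) :
    y t / A < z t := by
  have hr : ∀ t, y t ≠ 0 → 0 < deriv f (y t) * y t - f (y t) := fun t ht => by
    have h := hf.tangent_lt (by norm_num) (hy.gt_neg_one t) ht.symm
    rw [hf.map_zero] at h
    linarith
  have h := pos_of_periodic_of_hasDerivAt (u := fun t => z t - y t / A)
    (q := fun t => deriv f (y t)) (r := fun t => (deriv f (y t) * y t - f (y t)) / A)
    (forcingPeriod_pos hω) (fun t => by simp only [hzper t, hy.periodic t])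
    (fun t => ((hz t).sub ((hy.hasDerivAt t).div_const A)).congr_deriv (by field_simp; ring))
    (hy.continuous_deriv_comp hf) (fun t => hf.deriv_neg _ (hy.gt_neg_one t))
    (fun t => by
      rcases eq_or_ne (y t) 0 with h0 | h0
      · simp [h0, hf.map_zero]
      · exact (div_pos (hr t h0) hA).le)
    (by
      obtain ⟨s, hs⟩ := hy.exists_neg hf hω hA
      exact ⟨s, (div_pos (hr s hs.ne) hA).ne'⟩) t
  linarith

/-- The solution lies above the periodic solution of the equation linearized at `0`. -/
theorem linear_lt (hy : IsPeriodicSolution f ω A y) (hf : IsCrackLaw f fmin)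
    (hω : 0 < ω) (hA : 0 < A) (t : ℝ) :
    A * Real.cos (Real.arctan ω) * Real.sin (ω * t - Real.arctan ω) < y t := by
  set θ := Real.arctan ω with hθ
  have hcos : ω * Real.cos θ = Real.sin θ := by
    rw [← Real.tan_mul_cos (Real.cos_arctan_pos ω).ne', ← hθ, hθ, Real.tan_arctan]
  have hr : ∀ t, y t ≠ 0 → 0 < f (y t) + y t := fun t ht => by
    have h := hf.tangent_lt (hy.gt_neg_one t) (by norm_num) ht
    rw [hf.map_zero, hf.deriv_zero] at h
    linarith
  have h := pos_of_periodic_of_hasDerivAt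
    (u := fun t => y t - A * Real.cos θ * Real.sin (ω * t - θ))
    (q := fun _ => -1) (r := fun t => f (y t) + y t) (forcingPeriod_pos hω)
    (fun t => by
      have h1 : ω * (t + forcingPeriod ω) - θ = ω * t - θ + 2 * Real.pi := by
        linear_combination mul_forcingPeriod hω
      simp only [hy.periodic t, h1, Real.sin_add_two_pi])
    (fun t => by
      have hl : HasDerivAt (fun t => ω * t - θ) (ω * 1) t :=
        ((hasDerivAt_id t).const_mul ω).sub_const θ
      refine ((hy.hasDerivAt t).sub (hl.sin.const_mul (A * Real.cos θ))).congr_deriv ?_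
      have h1 : Real.sin (ω * t) = Real.sin (ω * t - θ) * Real.cos θ +
          Real.cos (ω * t - θ) * Real.sin θ := by
        rw [← Real.sin_add, sub_add_cancel]
      rw [h1]
      linear_combination (- A * Real.cos (ω * t - θ)) * hcos)
    continuous_const (fun _ => by norm_num)
    (fun t => by
      rcases eq_or_ne (y t) 0 with h0 | h0
      · simp [h0, hf.map_zero]
      · exact (hr t h0).le)
    (by
      obtain ⟨s, hs⟩ := hy.exists_neg hf hω hA
      exact ⟨s, (hr s hs.ne).ne'⟩) t
  linarith

theorem exists_isTheMaxTime (hy : IsPeriodicSolution f ω A y) (hf : IsCrackLaw f fmin)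
    (hω : 0 < ω) (hA : 0 < A) :
    ∃ s, IsTheMaxTime y (forcingPeriod ω) s ∧ s ∈ Ioo (forcingPeriod ω / 4) (3 * forcingPeriod ω / 4)
      ∧ f (y s) + A * Real.sin (ω * s) = 0 := by
  set T := forcingPeriod ω with hTdef
  have hT : 0 < T := forcingPeriod_pos hω
  set v : ℝ → ℝ := fun t => f (y (t - T / 4)) + A * Real.sin (ω * (t - T / 4)) with hv
  have hvper : Function.Periodic v T := fun t => by
    have h1 := hy.periodic (t - T / 4)
    have h2 := periodic_sin_mul hω (t - T / 4)
    simp only at h2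
    rw [sub_add_eq_add_sub, ← hTdef] at h1 h2
    simp only [hv, h1, h2]
  have hvd : ∀ t, HasDerivAt v (deriv f (y (t - T / 4)) * v t + A * ω * Real.sin (ω * t)) t := by
    intro t
    have h1 : HasDerivAt (fun t => f (y t) + A * Real.sin (ω * t)) _ (t - T / 4) :=
      (HasDerivAt.comp (t - T / 4) (hf.hasDerivAt (hy.gt_neg_one (t - T / 4)))
        (hy.hasDerivAt (t - T / 4))).add
        (((hasDerivAt_id (t - T / 4)).const_mul ω).sin.const_mul A)
    refine (h1.comp_sub_const t (T / 4)).congr_deriv ?_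
    have h2 : ω * (t - T / 4) = ω * t - Real.pi / 2 := by
      linear_combination (-1 / 4) * mul_forcingPeriod hω
    simp only [id, hv, h2, Real.cos_sub_pi_div_two]
    ring
  obtain ⟨t₁, t₂, h⟩ := _root_.exists_isNegPosNeg (q := fun t => deriv f (y (t - T / 4)))
    hω (mul_pos hA hω) hvper hvd
    ((hy.continuous_deriv_comp hf).comp (continuous_id.sub continuous_const))
    fun t => hf.deriv_neg _ (hy.gt_neg_one _)
  have h1 := h.pos_left
  have h2 := h.left_lt
  have h3 := h.lt_right
  have h4 := h.right_lt
  set w : ℝ → ℝ := fun t => y (t - T / 4) with hw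
  have hwd : ∀ t, HasDerivAt w (v t) t := fun t =>
    (hy.hasDerivAt (t - T / 4)).comp_sub_const t (T / 4)
  have hwc : Continuous w := continuous_of_forall_hasDerivAt hwd
  have hw0 : w T = w 0 := by
    have := hy.periodic (0 - T / 4)
    rw [sub_add_eq_add_sub, zero_add] at this
    exact this
  have ha1 : StrictAntiOn w (Icc 0 t₁) := by
    refine strictAntiOn_of_deriv_neg (convex_Icc _ _) hwc.continuousOn fun t ht => ?_
    rw [interior_Icc] at ht
    rw [(hwd t).deriv]
    exact h.neg_of_lt t ht.1.le ht.2
  have ha2 : StrictMonoOn w (Icc t₁ t₂) := by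
    refine strictMonoOn_of_deriv_pos (convex_Icc _ _) hwc.continuousOn fun t ht => ?_
    rw [interior_Icc] at ht
    rw [(hwd t).deriv]
    exact h.pos_of_mem t ht.1 ht.2
  have ha3 : StrictAntiOn w (Icc t₂ T) := by
    refine strictAntiOn_of_deriv_neg (convex_Icc _ _) hwc.continuousOn fun t ht => ?_
    rw [interior_Icc] at ht
    rw [(hwd t).deriv]
    exact h.neg_of_gt t ht.1 ht.2.le
  have hmax : ∀ s, 0 ≤ s → s ≤ T → s ≠ t₂ → w s < w t₂ := fun s hs0 hsT hne => by
    rcases hne.lt_or_gt with hlt | hgt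
    · rcases le_total t₁ s with h5 | h5
      · exact ha2 ⟨h5, hlt.le⟩ ⟨by linarith, le_rfl⟩ hlt
      · refine (ha1.antitoneOn ⟨le_rfl, h1.le⟩ ⟨hs0, h5⟩ hs0).trans_lt ?_
        rw [← hw0]
        exact ha3 ⟨le_rfl, h4.le⟩ ⟨h4.le, le_rfl⟩ h4
    · exact ha3 ⟨le_rfl, h4.le⟩ ⟨hgt.le, hsT⟩ hgt
  refine ⟨t₂ - T / 4, ⟨⟨by linarith, by linarith⟩, fun t ht hne => ?_⟩,
    ⟨by linarith, by linarith⟩, h.right_eq⟩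
  change y t < w t₂
  rcases le_total (t + T / 4) T with h5 | h5
  · have h6 := hmax (t + T / 4) (by linarith [ht.1]) h5 fun h => hne (by linarith)
    simpa only [hw, add_sub_cancel_right] using h6
  · have h6 := hmax (t + T / 4 - T) (by linarith) (by linarith [ht.2])
      fun h => by linarith [ht.2]
    have h7 := hy.periodic (t - T)
    rw [sub_add_cancel] at h7
    rw [h7]
    have h8 : t + T / 4 - T - T / 4 = t - T := by ring
    simpa only [hw, h8] using h6

end IsPeriodicSolution

/-- If `f` is bounded below by `c`, the maximum is attained at distance `O(1 / A)` to the left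
of `T / 2`. -/
theorem IsPeriodicSolution.maxTime_mem_Icc (hy : IsPeriodicSolution f ω A y)
    (hf : IsCrackLaw f fmin) (hω : 0 < ω) (hA : 0 < A) {c s : ℝ} (hc : ∀ x, -1 < x → c < f x)
    (hmax : IsTheMaxTime y (forcingPeriod ω) s)
    (hs : s ∈ Ioo (forcingPeriod ω / 4) (3 * forcingPeriod ω / 4))
    (hcrit : f (y s) + A * Real.sin (ω * s) = 0) :
    s ∈ Icc (forcingPeriod ω / 2 - Real.pi / 2 * (-c / ω) / A) (forcingPeriod ω / 2) := by
  set T := forcingPeriod ω with hTdef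
  have hT : 0 < T := forcingPeriod_pos hω
  have hωT : ω * T = 2 * Real.pi := mul_forcingPeriod hω
  obtain ⟨t₁, t₂, h⟩ := hy.exists_isNegPosNeg hf hω hA
  have hpos : 0 < y s := by
    have h1 := h.pos_of_mem (T / 2) h.left_lt h.lt_right
    rcases eq_or_ne (T / 2) s with h2 | h2
    · rwa [← h2]
    · exact h1.trans (hmax.2 _ ⟨by linarith, by linarith⟩ h2)
  have hsin : 0 < Real.sin (ω * s) := by
    have := hf.neg_of_pos hpos
    exact pos_of_mul_pos_right (by linarith : 0 < A * Real.sin (ω * s)) hA.le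
  have hle : s ≤ T / 2 := by
    by_contra! hlt
    exact hsin.not_gt (sin_mul_neg hω hlt (by linarith [hs.2]))
  have hφ := Real.mul_le_sin (x := Real.pi - ω * s) (by nlinarith) (by nlinarith [hs.1])
  rw [Real.sin_pi_sub] at hφ
  have hb := hc _ (hy.gt_neg_one s)
  refine ⟨?_, hle⟩
  have hpi := Real.pi_pos
  have h1 : A * (2 / Real.pi * (Real.pi - ω * s)) ≤ -c :=
    (mul_le_mul_of_nonneg_left hφ hA.le).trans (by linarith)
  have h2 : T / 2 - s = Real.pi / 2 * (A * (2 / Real.pi * (Real.pi - ω * s)) / ω) / A := by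
    field_simp
    linear_combination hωT
  have h3 : Real.pi / 2 * (A * (2 / Real.pi * (Real.pi - ω * s)) / ω) / A ≤
      Real.pi / 2 * (-c / ω) / A := by gcongr
  linarith

end

theorem corollary5p3 (f : ℝ → ℝ) (fmin : EReal) (hf : IsCrackLaw f fmin)
    (ω : ℝ) (hω : 0 < ω) :
    -- the objects of the result, each of them uniquely determined for all `A > 0`
    ∃ (Y Z : ℝ → ℝ → ℝ) (tY₁ tY₂ tYmax tZ₁ tZ₂ : ℝ → ℝ),
      (∀ A, 0 < A →
        -- `Y A` is the unique `T`-periodic solution, and `Z` is its derivative in `A`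
        (IsPeriodicSolution f ω A (Y A) ∧ ∀ y, IsPeriodicSolution f ω A y → y = Y A) ∧
        (∀ t, HasDerivAt (fun a => Y a t) (Z A t) A) ∧
        -- the critical times of `Y` and `Z`
        AreTheTwoRoots (Y A) (forcingPeriod ω) (tY₁ A) (tY₂ A) ∧
        AreTheTwoRoots (Z A) (forcingPeriod ω) (tZ₁ A) (tZ₂ A) ∧
        IsTheMaxTime (Y A) (forcingPeriod ω) (tYmax A)) ∧
      (∀ A, 0 < A →
        -- (i)
        (Icc (tY₁ A) (tY₂ A) ⊆ Icc (tZ₁ A) (tZ₂ A) ∧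
          0 ≤ Z A (tY₁ A) ∧ 0 ≤ Z A (tY₂ A)) ∧
        -- (ii)
        ((DifferentiableAt ℝ tY₁ A ∧ deriv tY₁ A < 0) ∧
          (DifferentiableAt ℝ tY₂ A ∧ 0 < deriv tY₂ A)) ∧
        -- (iii)
        (tY₁ A < Real.arctan ω / ω ∧
          Real.arctan ω / ω < forcingPeriod ω / 4 ∧
          Real.arctan ω / ω + forcingPeriod ω / 2 < tY₂ A)) ∧
      -- (iv)
      (fmin ≠ ⊥ → Tendsto tYmax atTop (𝓝 (forcingPeriod ω / 2))) := by
  have hT := forcingPeriod_pos hω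
  have hωT := mul_forcingPeriod hω
  have hpi := Real.pi_pos
  have eY : ∀ A, ∃ y, 0 < A → IsPeriodicSolution f ω A y := fun A => by
    by_cases hA : 0 < A
    · obtain ⟨y, hy⟩ := exists_isPeriodicSolution hf hω hA
      exact ⟨y, fun _ => hy⟩
    · exact ⟨0, fun h => absurd h hA⟩
  choose Y hY using eY
  have eZ : ∀ A, ∃ z : ℝ → ℝ, 0 < A → Function.Periodic z (forcingPeriod ω) ∧
      (∀ t, HasDerivAt z (deriv f (Y A t) * z t + Real.sin (ω * t)) t) ∧
      ∃ C, ∀ a, 0 < a → a < A + 1 → ∀ x, IsPeriodicSolution f ω a x →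
        ∀ t, |x t - Y A t - (a - A) * z t| ≤ C * (a - A) ^ 2 := fun A => by
    by_cases hA : 0 < A
    · obtain ⟨z, hz⟩ := exists_sensitivity hf hω hA (hY A hA)
      exact ⟨z, fun _ => hz⟩
    · exact ⟨0, fun h => absurd h hA⟩
  choose Z hZ using eZ
  have etY : ∀ A, ∃ t₁ t₂, 0 < A → IsNegPosNeg (Y A) (forcingPeriod ω) t₁ t₂ := fun A => by
    by_cases hA : 0 < A
    · obtain ⟨t₁, t₂, h⟩ := (hY A hA).exists_isNegPosNeg hf hω hA
      exact ⟨t₁, t₂, fun _ => h⟩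
    · exact ⟨0, 0, fun h => absurd h hA⟩
  choose tY₁ tY₂ htY using etY
  have etZ : ∀ A, ∃ t₁ t₂, 0 < A → IsNegPosNeg (Z A) (forcingPeriod ω) t₁ t₂ := fun A => by
    by_cases hA : 0 < A
    · obtain ⟨t₁, t₂, h⟩ := exists_isNegPosNeg (q := fun t => deriv f (Y A t)) hω one_pos
        (hZ A hA).1 (by simpa only [one_mul] using (hZ A hA).2.1)
        ((hY A hA).continuous_deriv_comp hf) fun t => hf.deriv_neg _ ((hY A hA).gt_neg_one t)
      exact ⟨t₁, t₂, fun _ => h⟩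
    · exact ⟨0, 0, fun h => absurd h hA⟩
  choose tZ₁ tZ₂ htZ using etZ
  have etM : ∀ A, ∃ s, 0 < A → IsTheMaxTime (Y A) (forcingPeriod ω) s ∧
      s ∈ Ioo (forcingPeriod ω / 4) (3 * forcingPeriod ω / 4) ∧
      f (Y A s) + A * Real.sin (ω * s) = 0 := fun A => by
    by_cases hA : 0 < A
    · obtain ⟨s, h⟩ := (hY A hA).exists_isTheMaxTime hf hω hA
      exact ⟨s, fun _ => h⟩
    · exact ⟨0, fun h => absurd h hA⟩
  choose tM htM using etM
  have hlin : ∀ A, 0 < A → ∃ C, ∀ᶠ a in 𝓝 A, ∀ t,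
      |Y a t - Y A t - (a - A) * Z A t| ≤ C * (a - A) ^ 2 := fun A hA => by
    obtain ⟨C, hC⟩ := (hZ A hA).2.2
    refine ⟨C, ?_⟩
    filter_upwards [Ioo_mem_nhds hA (lt_add_one A)] with a ha
    exact hC a ha.1 ha.2 _ (hY a ha.1)
  have hder : ∀ A, 0 < A → ∀ t, HasDerivAt (fun a => Y a t) (Z A t) A := fun A hA t => by
    obtain ⟨C, hC⟩ := hlin A hA
    exact hasDerivAt_of_abs_sub_le_sq (hC.mono fun a ha => ha t)
  refine ⟨Y, Z, tY₁, tY₂, tM, tZ₁, tZ₂, fun A hA => ⟨⟨hY A hA, fun y hy => hy.eq (hY A hA) hf hω⟩,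
    hder A hA, (htY A hA).areTheTwoRoots, (htZ A hA).areTheTwoRoots, (htM A hA).1⟩,
    fun A hA => ?_, fun hfmin => ?_⟩
  · have hP := htY A hA
    have h1 := hP.pos_left
    have h2 := hP.left_lt
    have h3 := hP.lt_right
    have h4 := hP.right_lt
    have hZpos : ∀ t, Y A t = 0 → 0 < Z A t := fun t ht => by
      have := (hY A hA).div_lt_sensitivity hf hω hA (hZ A hA).1 (hZ A hA).2.1 t
      rwa [ht, zero_div] at this
    have hZ1 := hZpos _ hP.left_eq
    have hZ2 := hZpos _ hP.right_eq
    have hev : ∀ᶠ a in 𝓝 A, IsNegPosNeg (Y a) (forcingPeriod ω) (tY₁ a) (tY₂ a) := by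
      filter_upwards [Ioi_mem_nhds hA] with a ha using htY a ha
    have hcont : ∀ t, ContinuousAt (fun a => Y a t) A := fun t => (hder A hA t).continuousAt
    have hZc : Continuous (Z A) := continuous_of_forall_hasDerivAt (hZ A hA).2.1
    obtain ⟨C, hC⟩ := hlin A hA
    have hdY : ∀ t, Y A t = 0 → HasDerivAt (Y A) (A * Real.sin (ω * t)) t := fun t ht =>
      ((hY A hA).hasDerivAt t).congr_deriv (by rw [ht, hf.map_zero, zero_add])
    have hs1 : 0 < A * Real.sin (ω * tY₁ A) := mul_pos hA (sin_mul_pos hω h1 h2)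
    have hs2 : A * Real.sin (ω * tY₂ A) < 0 := mul_neg_of_pos_of_neg hA (sin_mul_neg hω h3 h4)
    have hd1 := hasDerivAt_root hC hZc.continuousAt (hdY _ hP.left_eq) hs1.ne'
      (continuousAt_left_root hcont hev) (hev.mono fun a ha => ha.left_eq)
    have hd2 := hasDerivAt_root hC hZc.continuousAt (hdY _ hP.right_eq) hs2.ne
      (continuousAt_right_root hcont hev) (hev.mono fun a ha => ha.right_eq)
    have hθ0 : 0 < Real.arctan ω / ω := div_pos (Real.arctan_pos.2 hω) hω
    have hθ1 : Real.arctan ω / ω < forcingPeriod ω / 4 := by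
      rw [div_lt_iff₀ hω]
      linarith [Real.arctan_lt_pi_div_two ω]
    have hl : ∀ t, Real.sin (ω * t - Real.arctan ω) = 0 → 0 < Y A t := fun t ht => by
      have := (hY A hA).linear_lt hf hω hA t
      rwa [ht, mul_zero] at this
    have hp1 := hP.mem_Ioo_of_pos (t := Real.arctan ω / ω) hθ0.le (by linarith) (hl _ (by
      rw [mul_div_cancel₀ _ hω.ne', sub_self, Real.sin_zero]))
    have hp2 := hP.mem_Ioo_of_pos (t := Real.arctan ω / ω + forcingPeriod ω / 2) (by linarith)
      (by linarith) (hl _ (by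
        have : ω * (Real.arctan ω / ω + forcingPeriod ω / 2) - Real.arctan ω = Real.pi := by
          field_simp
          linarith
        rw [this, Real.sin_pi]))
    refine ⟨⟨Icc_subset_Icc ?_ ?_, hZ1.le, hZ2.le⟩, ⟨⟨hd1.differentiableAt, ?_⟩,
      ⟨hd2.differentiableAt, ?_⟩⟩, hp1.1, hθ1, hp2.2⟩
    · exact ((htZ A hA).mem_Icc_of_nonneg h1.le (by linarith) hZ1.le).1
    · exact ((htZ A hA).mem_Icc_of_nonneg (by linarith) h4.le hZ2.le).2
    · rw [hd1.deriv]
      exact div_neg_of_neg_of_pos (neg_lt_zero.2 hZ1) hs1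
    · rw [hd2.deriv]
      exact div_pos_of_neg_of_neg (neg_lt_zero.2 hZ2) hs2
  · have hc : ∀ x, -1 < x → fmin.toReal < f x := fun x hx => by
      have h1 : f x ∈ {x : ℝ | fmin < (x : EReal)} := hf.image_eq ▸ mem_image_of_mem f hx
      have h2 : fmin < (f x : EReal) := h1
      rwa [← EReal.coe_toReal (hf.fmin_neg.trans EReal.zero_lt_top).ne hfmin,
        EReal.coe_lt_coe_iff] at h2
    have hlim : Tendsto (fun A : ℝ => forcingPeriod ω / 2 -
        Real.pi / 2 * (-fmin.toReal / ω) / A) atTop (𝓝 (forcingPeriod ω / 2)) := by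
      simpa using (tendsto_const_nhds (x := forcingPeriod ω / 2)).sub
        (tendsto_const_nhds (x := Real.pi / 2 * (-fmin.toReal / ω)).div_atTop tendsto_id)
    refine tendsto_of_tendsto_of_tendsto_of_le_of_le' hlim tendsto_const_nhds ?_ ?_
    all_goals
      filter_upwards [eventually_gt_atTop 0] with A hA
      obtain ⟨hm1, hm2, hm3⟩ := htM A hA
    · exact ((hY A hA).maxTime_mem_Icc hf hω hA hc hm1 hm2 hm3).1
    · exact ((hY A hA).maxTime_mem_Icc hf hω hA hc hm1 hm2 hm3).2
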